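/- Let $K$ be a field. A directed graph $E=(E^0,E^1,r,s)$ consists of a set $E^0$ of vertices, a set $E^1$ of edges, and range and source maps $r,s\colon E^1\to E^0$; no finiteness is assumed. Write $v\ge w$ if there is a path (possibly of length $0$) from $v$ to $w$. A vertex is regular if it emits at least one and only finitely many edges. A set $X\subseteq E^0$ is hereditary if $v\in X$ and $v\ge w$ imply $w\in X$; it is saturated if every regular vertex $v$ with $r(s^{-1}(v))\subseteq X$ belongs to $X$. The Leavitt path algebra $L_K(E)$ is the associative (not necessarily unital) $K$-algebra generated by $E^0\cup E^1\cup\{e^*: e\in E^1\}$ subject to the relations $vw=\delta_{v,w}v$ for $v,w\in E^0$; $s(e)e=e=e\,r(e)$ and $r(e)e^*=e^*=e^*s(e)$ for $e\in E^1$; $e^*f=\delta_{e,f}\,r(e)$ for $e,f\in E^1$; and $v=\sum_{s(e)=v}ee^*$ for every regular vertex $v$. For $X\subseteq E^0$, let $I(X)$ be the two-sided ideal of $L_K(E)$ generated by $X$. Let $\mathcal{Grph}$ be the category whose objects are the directed graphs and whose morphisms are the graph isomorphisms. A point functor is a subfunctor $H$ of the functor $\mathcal{Grph}\to\mathcal{Set}$,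 $E\mapsto E^0$; thus $H(E)\subseteq E^0$ for each graph $E$, and each graph isomorphism $E\to E'$ maps $H(E)$ into $H(E')$. It is hereditary (respectively saturated) if $H(E)$ is a hereditary (respectively saturated) subset of $E^0$ for every graph $E$. Unions and intersections of point functors are formed objectwise: $(H_1\cup H_2)(E)=H_1(E)\cup H_2(E)$ and $(H_1\cap H_2)(E)=H_1(E)\cap H_2(E)$. Given graphs $E,F$ and a ring isomorphism $f\colon L_K(E)\to L_K(F)$, a point functor $H$ is called $f$-invariant if $f(I(H(E)))=I(H(F))$. **Proposition.** Let $E$ and $F$ be directed graphs, let $f\colon L_K(E)\to L_K(F)$ be a ring isomorphism, and let $H_1$ and $H_2$ be hereditary and saturated point functors. If $H_1$ and $H_2$ are $f$-invariant, then $H_1\cup H_2$ and $H_1\cap H_2$ are $f$-invariant point functors. -/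

import Mathlib

open CategoryTheory

universe u v w

/-- A directed graph `E = (E⁰, E¹, r, s)`: `src` is the source map `s`, `tgt` the range map `r`.
No finiteness condition is imposed. -/
structure DirGraph where
  Vertex : Type u
  Edge : Type v
  src : Edge → Vertex
  tgt : Edge → Vertex

namespace DirGraph

/-! ### Paths, hereditary sets, saturated sets -/

/-- `E.Reaches a b` is `a ≥ b`: there is a path (possibly of length `0`) from `a` to `b`. -/
def Reaches (E : DirGraph.{u, v}) : E.Vertex → E.Vertex → Prop :=
  Relation.ReflTransGen fun a b => ∃ e : E.Edge, E.src e = a ∧ E.tgt e = b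

/-- A vertex is regular if it is neither a sink nor an infinite emitter. -/
def IsRegular (E : DirGraph.{u, v}) (a : E.Vertex) : Prop :=
  {e : E.Edge | E.src e = a}.Nonempty ∧ {e : E.Edge | E.src e = a}.Finite

def IsHereditary (E : DirGraph.{u, v}) (X : Set E.Vertex) : Prop :=
  ∀ a ∈ X, ∀ b, E.Reaches a b → b ∈ X

def IsSaturated (E : DirGraph.{u, v}) (X : Set E.Vertex) : Prop :=
  ∀ a, E.IsRegular a → E.tgt '' {e : E.Edge | E.src e = a} ⊆ X → a ∈ X

/-! ### The category of graphs and graph isomorphisms -/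

/-- An isomorphism of directed graphs. -/
@[ext]
structure Iso (E F : DirGraph.{u, v}) where
  onVertex : E.Vertex ≃ F.Vertex
  onEdge : E.Edge ≃ F.Edge
  src_eq : ∀ e, F.src (onEdge e) = onVertex (E.src e)
  tgt_eq : ∀ e, F.tgt (onEdge e) = onVertex (E.tgt e)

/-- The category of directed graphs whose morphisms are the graph isomorphisms. -/
instance : Category.{max u v} DirGraph.{u, v} where
  Hom E F := Iso E F
  id E := ⟨Equiv.refl _, Equiv.refl _, fun _ => rfl, fun _ => rfl⟩
  comp α β := ⟨α.onVertex.trans β.onVertex, α.onEdge.trans β.onEdge,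
    fun e => by simp [α.src_eq, β.src_eq], fun e => by simp [α.tgt_eq, β.tgt_eq]⟩

/-- The functor sending a graph `E` to its set `E⁰` of vertices. -/
def vertexFunctor : DirGraph.{u, v} ⥤ Type u where
  obj E := E.Vertex
  map α := TypeCat.ofHom (Iso.onVertex α)

/-! ### Leavitt path algebras -/

/-- The generators of the Leavitt path algebra: the vertices, the (real) edges `e`
and the ghost edges `e*`. -/
inductive LeavittGen (E : DirGraph.{u, v}) : Type (max u v)
  | vertex (a : E.Vertex)
  | edge (e : E.Edge)
  | ghost (e : E.Edge)

section Leavitt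

variable (K : Type w) [Field K] (E : DirGraph.{u, v})

/-- A generator as an element of the free algebra. -/
abbrev freeGen (x : E.LeavittGen) : FreeAlgebra K E.LeavittGen := FreeAlgebra.ι K x

open LeavittGen in
/-- The defining relations of the Leavitt path algebra of `E`. -/
inductive LeavittRel : FreeAlgebra K E.LeavittGen → FreeAlgebra K E.LeavittGen → Prop
  | vertex_mul_self (a : E.Vertex) :
      LeavittRel (E.freeGen K (vertex a) * E.freeGen K (vertex a)) (E.freeGen K (vertex a))
  | vertex_mul_vertex (a b : E.Vertex) (hab : a ≠ b) :
      LeavittRel (E.freeGen K (vertex a) * E.freeGen K (vertex b)) 0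
  | src_mul_edge (e : E.Edge) :
      LeavittRel (E.freeGen K (vertex (E.src e)) * E.freeGen K (edge e)) (E.freeGen K (edge e))
  | edge_mul_tgt (e : E.Edge) :
      LeavittRel (E.freeGen K (edge e) * E.freeGen K (vertex (E.tgt e))) (E.freeGen K (edge e))
  | tgt_mul_ghost (e : E.Edge) :
      LeavittRel (E.freeGen K (vertex (E.tgt e)) * E.freeGen K (ghost e)) (E.freeGen K (ghost e))
  | ghost_mul_src (e : E.Edge) :
      LeavittRel (E.freeGen K (ghost e) * E.freeGen K (vertex (E.src e))) (E.freeGen K (ghost e))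
  /-- First Cuntz–Krieger relation, equal edges. -/
  | ghost_mul_self (e : E.Edge) :
      LeavittRel (E.freeGen K (ghost e) * E.freeGen K (edge e)) (E.freeGen K (vertex (E.tgt e)))
  /-- First Cuntz–Krieger relation, distinct edges. -/
  | ghost_mul_edge (e f : E.Edge) (hef : e ≠ f) :
      LeavittRel (E.freeGen K (ghost e) * E.freeGen K (edge f)) 0
  /-- Second Cuntz–Krieger relation, at every regular vertex. -/
  | regular (a : E.Vertex) (ha : E.IsRegular a) :
      LeavittRel (E.freeGen K (vertex a))
        (∑ e ∈ ha.2.toFinset, E.freeGen K (edge e) * E.freeGen K (ghost e))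

/-- The unital `K`-algebra presented by the generators and relations above. The relations have no
constant terms, so this is the unitization of the (possibly non-unital) Leavitt path algebra. -/
abbrev UnitalLeavitt : Type (max u v w) := RingQuot (E.LeavittRel K)

/-- A generator as an element of `UnitalLeavitt`. -/
def unitalGen (x : E.LeavittGen) : E.UnitalLeavitt K :=
  RingQuot.mkAlgHom K (E.LeavittRel K) (E.freeGen K x)

/-- The Leavitt path algebra `L_K(E)`: the associative, not necessarily unital `K`-algebra
generated by vertices, edges and ghost edges subject to the defining relations, realized inside its
unitization as the non-unital subalgebra generated by the generators. -/
abbrev LeavittPathAlgebra : Type (max u v w) :=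
  ↥(NonUnitalAlgebra.adjoin K (Set.range (E.unitalGen K)))

/-- A vertex as an element of `L_K(E)`. -/
def vertexElem (a : E.Vertex) : E.LeavittPathAlgebra K :=
  ⟨E.unitalGen K (LeavittGen.vertex a), NonUnitalAlgebra.subset_adjoin K ⟨_, rfl⟩⟩

/-- The ideal `I(X)` of `L_K(E)` generated by a set `X` of vertices. It is generated as an ideal of
the ring; it is automatically stable under scalars, as `k • a = (k • a) * a` for a vertex `a`. -/
def vertexIdeal (X : Set E.Vertex) : TwoSidedIdeal (E.LeavittPathAlgebra K) :=
  TwoSidedIdeal.span (E.vertexElem K '' X)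

end Leavitt

end DirGraph

/-! ### Point functors -/

/-- A point functor is a subfunctor of the vertex functor `E ↦ E⁰` on the category of graphs and
graph isomorphisms. The union and intersection of point functors (computed objectwise) are the
lattice operations `⊔` and `⊓`. -/
abbrev PointFunctor : Type (max (u + 1) (v + 1)) :=
  Subfunctor DirGraph.vertexFunctor.{u, v}

namespace PointFunctor

/-- The set of vertices `H(E) ⊆ E⁰`. -/
def verts (H : PointFunctor.{u, v}) (E : DirGraph.{u, v}) : Set E.Vertex := H.obj E

def IsHereditary (H : PointFunctor.{u, v}) : Prop := ∀ E : DirGraph.{u, v}, E.IsHereditary (H.verts E)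

def IsSaturated (H : PointFunctor.{u, v}) : Prop := ∀ E : DirGraph.{u, v}, E.IsSaturated (H.verts E)

/-- `H₁` is `f`-related to `H₂` if `f(I(H₁(E))) = I(H₂(F))`. -/
def IsRelated {K : Type w} [Field K] {E F : DirGraph.{u, v}}
    (f : E.LeavittPathAlgebra K ≃+* F.LeavittPathAlgebra K) (H₁ H₂ : PointFunctor.{u, v}) : Prop :=
  f '' (E.vertexIdeal K (H₁.verts E) : Set (E.LeavittPathAlgebra K)) =
    (F.vertexIdeal K (H₂.verts F) : Set (F.LeavittPathAlgebra K))

/-- `H` is `f`-invariant if it is `f`-related to itself. -/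
def IsInvariant {K : Type w} [Field K] {E F : DirGraph.{u, v}}
    (f : E.LeavittPathAlgebra K ≃+* F.LeavittPathAlgebra K) (H : PointFunctor.{u, v}) : Prop :=
  IsRelated f H H

end PointFunctor

/-!
An `f`-invariant point functor is one for which both `f` and its inverse send the generating
vertices of one ideal into the other ideal. For `H₁ ⊔ H₂` this is immediate.

For `H₁ ⊓ H₂` the point is that, for hereditary sets `X` and `Y`, the ideal `I(X ∩ Y)` is described
by the product of `I(X)` and `I(Y)`, and ring isomorphisms respect products:
* a vertex `a ∈ X ∩ Y` is the product `a * a` of an element of `I(X)` and an element of `I(Y)`;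
* conversely `I(X) I(Y) ⊆ I(X ∩ Y)` (`mul_mem_vertexIdeal_inter`). Since vertices are idempotent, it
  suffices (`TwoSidedIdeal.mul_mem_of_mem_span`) that `a r b ∈ I(X ∩ Y)`
  for `a ∈ X`, `b ∈ Y` and `r ∈ L_K(E)`. The algebra is spanned by the monomials `p q*` with `p`, `q`
  paths of the same range `c` (`mem_monomialSpan`), and `a p q* b` vanishes unless `p` starts at `a`
  and `q` starts at `b`. In that case `c` is reachable from both `a` and `b`, so
  `c ∈ X ∩ Y`, and `p q* = p c q*`.
-/

/-! ### Ideals generated by a set -/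

namespace TwoSidedIdeal

/-- The product of the ideals generated by `S` and `T` is contained in `J` as soon as `s r t ∈ J`
for all `s ∈ S`, `t ∈ T` and `r`. Idempotency of the elements of `S` replaces the missing unit. -/
theorem mul_mem_of_mem_span {R : Type*} [NonUnitalRing R] {S T : Set R} {J : TwoSidedIdeal R}
    (hS : ∀ s ∈ S, s * s = s) (hST : ∀ s ∈ S, ∀ r, ∀ t ∈ T, s * r * t ∈ J)
    {x y : R} (hx : x ∈ span S) (hy : y ∈ span T) : x * y ∈ J := by
  have key : ∀ s ∈ S, ∀ r, s * r * y ∈ J := by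
    intro s hs
    induction hy using span_induction with
    | mem t ht => exact fun r => hST s hs r t ht
    | zero => intro r; rw [mul_zero]; exact zero_mem _
    | add y z _ _ hy hz => intro r; rw [mul_add]; exact J.add_mem (hy r) (hz r)
    | neg y _ hy => intro r; rw [mul_neg]; exact J.neg_mem (hy r)
    | left_absorb t y _ hy =>
      intro r
      rw [← mul_assoc, mul_assoc s r t]
      exact hy (r * t)
    | right_absorb t y _ hy =>
      intro r
      rw [← mul_assoc]
      exact J.mul_mem_right _ _ (hy r)
  -- Carrying the factor `r` along makes the induction pass through right multiplication of `x`.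
  suffices ∀ r, x * (r * y) ∈ J ∧ x * y ∈ J from (this 0).2
  induction hx using span_induction with
  | mem s hs =>
    refine fun r => ⟨by rw [← mul_assoc]; exact key s hs r, ?_⟩
    rw [← hS s hs]
    exact key s hs s
  | zero => intro r; simp only [zero_mul]; exact ⟨zero_mem _, zero_mem _⟩
  | add x z _ _ hx hz =>
    intro r
    simp only [add_mul]
    exact ⟨J.add_mem (hx r).1 (hz r).1, J.add_mem (hx r).2 (hz r).2⟩
  | neg x _ hx =>
    intro r
    simp only [neg_mul]
    exact ⟨J.neg_mem (hx r).1, J.neg_mem (hx r).2⟩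
  | left_absorb t x _ hx =>
    intro r
    simp only [mul_assoc t x]
    exact ⟨J.mul_mem_left _ _ (hx r).1, J.mul_mem_left _ _ (hx r).2⟩
  | right_absorb t x _ hx =>
    intro r
    simp only [mul_assoc x t]
    exact ⟨by rw [← mul_assoc t]; exact (hx (t * r)).1, (hx t).1⟩

/-- A ring isomorphism maps `span S` onto `span T` if and only if it maps `S` into `span T` and its
inverse maps `T` into `span S`. -/
theorem image_span_eq_span_iff {R R' : Type*} [NonUnitalNonAssocRing R]
    [NonUnitalNonAssocRing R'] (f : R ≃+* R')
    {S : Set R} {T : Set R'} :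
    f '' (span S : Set R) = (span T : Set R') ↔
      (∀ s ∈ S, f s ∈ span T) ∧ ∀ t ∈ T, f.symm t ∈ span S := by
  constructor
  · intro h
    refine ⟨fun s hs => ?_, fun t ht => ?_⟩
    · rw [← SetLike.mem_coe, ← h]
      exact ⟨s, subset_span hs, rfl⟩
    · obtain ⟨x, hx, rfl⟩ := h.ge (subset_span ht)
      rwa [f.symm_apply_apply]
  · rintro ⟨h, h'⟩
    have hle : span S ≤ (span T).comap f :=
      span_le.2 fun s hs => (mem_comap f).2 (h s hs)
    have hle' : span T ≤ (span S).comap f.symm :=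
      span_le.2 fun t ht => (mem_comap f.symm).2 (h' t ht)
    apply Set.Subset.antisymm
    · rintro _ ⟨x, hx, rfl⟩
      exact (mem_comap f).1 (hle hx)
    · intro y hy
      exact ⟨f.symm y, (mem_comap f.symm).1 (hle' hy), f.apply_symm_apply y⟩

end TwoSidedIdeal

namespace DirGraph

open LeavittGen

variable (K : Type w) [Field K] (E : DirGraph.{u, v})

theorem Reaches.head {E : DirGraph.{u, v}} (e : E.Edge) {b : E.Vertex}
    (h : E.Reaches (E.tgt e) b) : E.Reaches (E.src e) b :=
  Relation.ReflTransGen.head ⟨e, rfl, rfl⟩ h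

/-! ### The defining relations -/

theorem unitalGen_vertex_mul_self (a : E.Vertex) :
    E.unitalGen K (vertex a) * E.unitalGen K (vertex a) = E.unitalGen K (vertex a) := by
  simpa [unitalGen] using RingQuot.mkAlgHom_rel K (LeavittRel.vertex_mul_self (K := K) a)

theorem unitalGen_vertex_mul_vertex {a b : E.Vertex} (hab : a ≠ b) :
    E.unitalGen K (vertex a) * E.unitalGen K (vertex b) = 0 := by
  simpa [unitalGen] using RingQuot.mkAlgHom_rel K (LeavittRel.vertex_mul_vertex (K := K) a b hab)

theorem unitalGen_src_mul_edge (e : E.Edge) :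
    E.unitalGen K (vertex (E.src e)) * E.unitalGen K (edge e) = E.unitalGen K (edge e) := by
  simpa [unitalGen] using RingQuot.mkAlgHom_rel K (LeavittRel.src_mul_edge (K := K) e)

theorem unitalGen_edge_mul_tgt (e : E.Edge) :
    E.unitalGen K (edge e) * E.unitalGen K (vertex (E.tgt e)) = E.unitalGen K (edge e) := by
  simpa [unitalGen] using RingQuot.mkAlgHom_rel K (LeavittRel.edge_mul_tgt (K := K) e)

theorem unitalGen_tgt_mul_ghost (e : E.Edge) :
    E.unitalGen K (vertex (E.tgt e)) * E.unitalGen K (ghost e) = E.unitalGen K (ghost e) := by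
  simpa [unitalGen] using RingQuot.mkAlgHom_rel K (LeavittRel.tgt_mul_ghost (K := K) e)

theorem unitalGen_ghost_mul_src (e : E.Edge) :
    E.unitalGen K (ghost e) * E.unitalGen K (vertex (E.src e)) = E.unitalGen K (ghost e) := by
  simpa [unitalGen] using RingQuot.mkAlgHom_rel K (LeavittRel.ghost_mul_src (K := K) e)

theorem unitalGen_ghost_mul_self (e : E.Edge) :
    E.unitalGen K (ghost e) * E.unitalGen K (edge e) = E.unitalGen K (vertex (E.tgt e)) := by
  simpa [unitalGen] using RingQuot.mkAlgHom_rel K (LeavittRel.ghost_mul_self (K := K) e)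

theorem unitalGen_ghost_mul_edge {e f : E.Edge} (hef : e ≠ f) :
    E.unitalGen K (ghost e) * E.unitalGen K (edge f) = 0 := by
  simpa [unitalGen] using RingQuot.mkAlgHom_rel K (LeavittRel.ghost_mul_edge (K := K) e f hef)

/-! ### Monomials spanning the Leavitt path algebra -/

/-- `E.IsPathElem K a c p`: the element `p` is the product of the edges of a path from `a` to `c`
(and `p = a` for the path of length `0`). -/
inductive IsPathElem : E.Vertex → E.Vertex → E.UnitalLeavitt K → Prop
  | nil (a : E.Vertex) : IsPathElem a a (E.unitalGen K (vertex a))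
  | cons (e : E.Edge) {c : E.Vertex} {p : E.UnitalLeavitt K} (h : IsPathElem (E.tgt e) c p) :
      IsPathElem (E.src e) c (E.unitalGen K (edge e) * p)

/-- `E.IsGhostElem K c b q`: the element `q` is the ghost `β*` of a path `β` from `b` to `c`. The
path `β` is built by adding edges at its end, so that `β*` grows on the left. -/
inductive IsGhostElem : E.Vertex → E.Vertex → E.UnitalLeavitt K → Prop
  | nil (a : E.Vertex) : IsGhostElem a a (E.unitalGen K (vertex a))
  | cons (e : E.Edge) {b : E.Vertex} {q : E.UnitalLeavitt K} (h : IsGhostElem (E.src e) b q) :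
      IsGhostElem (E.tgt e) b (E.unitalGen K (ghost e) * q)

/-- The linear span of the monomials `α β*`, for paths `α` and `β` with the same range. -/
def monomialSpan : Submodule K (E.UnitalLeavitt K) :=
  Submodule.span K {x | ∃ a b c p q, E.IsPathElem K a c p ∧ E.IsGhostElem K c b q ∧ x = p * q}

variable {K E}

theorem unitalGen_mem_adjoin (x : E.LeavittGen) :
    E.unitalGen K x ∈ NonUnitalAlgebra.adjoin K (Set.range (E.unitalGen K)) :=
  NonUnitalAlgebra.subset_adjoin K ⟨x, rfl⟩

namespace IsPathElem

variable {a c : E.Vertex} {p : E.UnitalLeavitt K}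

theorem reaches (h : E.IsPathElem K a c p) : E.Reaches a c := by
  induction h with
  | nil a => exact .refl
  | cons e _ ih => exact ih.head e

theorem mem_adjoin (h : E.IsPathElem K a c p) :
    p ∈ NonUnitalAlgebra.adjoin K (Set.range (E.unitalGen K)) := by
  induction h with
  | nil a => exact unitalGen_mem_adjoin _
  | cons e _ ih => exact mul_mem (unitalGen_mem_adjoin _) ih

theorem vertex_mul (h : E.IsPathElem K a c p) : E.unitalGen K (vertex a) * p = p := by
  cases h with
  | nil => exact unitalGen_vertex_mul_self K E a
  | cons e h => rw [← mul_assoc, unitalGen_src_mul_edge]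

theorem vertex_mul_of_ne (h : E.IsPathElem K a c p) {b : E.Vertex} (hb : b ≠ a) :
    E.unitalGen K (vertex b) * p = 0 := by
  rw [← h.vertex_mul, ← mul_assoc, unitalGen_vertex_mul_vertex K E hb, zero_mul]

theorem mul_vertex (h : E.IsPathElem K a c p) : p * E.unitalGen K (vertex c) = p := by
  induction h with
  | nil a => exact unitalGen_vertex_mul_self K E a
  | cons e _ ih => rw [mul_assoc, ih]

end IsPathElem

namespace IsGhostElem

variable {c b : E.Vertex} {q : E.UnitalLeavitt K}

theorem reaches (h : E.IsGhostElem K c b q) : E.Reaches b c := by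
  induction h with
  | nil a => exact .refl
  | cons e _ ih => exact ih.tail ⟨e, rfl, rfl⟩

theorem mem_adjoin (h : E.IsGhostElem K c b q) :
    q ∈ NonUnitalAlgebra.adjoin K (Set.range (E.unitalGen K)) := by
  induction h with
  | nil a => exact unitalGen_mem_adjoin _
  | cons e _ ih => exact mul_mem (unitalGen_mem_adjoin _) ih

theorem vertex_mul (h : E.IsGhostElem K c b q) : E.unitalGen K (vertex c) * q = q := by
  cases h with
  | nil => exact unitalGen_vertex_mul_self K E c
  | cons e h => rw [← mul_assoc, unitalGen_tgt_mul_ghost]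

theorem mul_vertex (h : E.IsGhostElem K c b q) : q * E.unitalGen K (vertex b) = q := by
  induction h with
  | nil a => exact unitalGen_vertex_mul_self K E a
  | cons e _ ih => rw [mul_assoc, ih]

theorem mul_vertex_of_ne (h : E.IsGhostElem K c b q) {a : E.Vertex} (ha : b ≠ a) :
    q * E.unitalGen K (vertex a) = 0 := by
  rw [← h.mul_vertex, mul_assoc, unitalGen_vertex_mul_vertex K E ha, mul_zero]

end IsGhostElem

theorem mul_mem_monomialSpan {a b c : E.Vertex} {p q : E.UnitalLeavitt K}
    (hp : E.IsPathElem K a c p) (hq : E.IsGhostElem K c b q) : p * q ∈ E.monomialSpan K :=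
  Submodule.subset_span ⟨a, b, c, p, q, hp, hq, rfl⟩

/-- Multiplying a monomial `α β*` by a generator on the left gives a monomial or `0`. -/
theorem unitalGen_mul_mul_mem_monomialSpan (g : E.LeavittGen) {a b c : E.Vertex}
    {p q : E.UnitalLeavitt K} (hp : E.IsPathElem K a c p) (hq : E.IsGhostElem K c b q) :
    E.unitalGen K g * (p * q) ∈ E.monomialSpan K := by
  rw [← mul_assoc]
  cases g with
  | vertex d =>
    by_cases hd : d = a
    · subst hd
      rw [hp.vertex_mul]
      exact mul_mem_monomialSpan hp hq
    · rw [hp.vertex_mul_of_ne hd, zero_mul]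
      exact zero_mem _
  | edge e =>
    by_cases he : E.tgt e = a
    · subst he
      exact mul_mem_monomialSpan (.cons e hp) hq
    · rw [← unitalGen_edge_mul_tgt, mul_assoc, mul_assoc, ← mul_assoc _ p,
        hp.vertex_mul_of_ne he, zero_mul, mul_zero]
      exact zero_mem _
  | ghost e =>
    cases hp with
    | nil =>
      by_cases he : E.src e = a
      · subst he
        rw [mul_assoc, hq.vertex_mul, ← (IsGhostElem.cons e hq).vertex_mul]
        exact mul_mem_monomialSpan (.nil _) (.cons e hq)
      · rw [← unitalGen_ghost_mul_src, mul_assoc (E.unitalGen K (ghost e)),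
          unitalGen_vertex_mul_vertex K E he, mul_zero, zero_mul]
        exact zero_mem _
    | @cons f _ p hp =>
      rw [← mul_assoc]
      by_cases hef : e = f
      · subst hef
        rw [unitalGen_ghost_mul_self, hp.vertex_mul]
        exact mul_mem_monomialSpan hp hq
      · rw [unitalGen_ghost_mul_edge K E hef, zero_mul, zero_mul]
        exact zero_mem _

theorem unitalGen_mul_mem_monomialSpan (g : E.LeavittGen) {x : E.UnitalLeavitt K}
    (hx : x ∈ E.monomialSpan K) : E.unitalGen K g * x ∈ E.monomialSpan K := by
  induction hx using Submodule.span_induction with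
  | mem x hx =>
    obtain ⟨a, b, c, p, q, hp, hq, rfl⟩ := hx
    exact unitalGen_mul_mul_mem_monomialSpan g hp hq
  | zero => rw [mul_zero]; exact zero_mem _
  | add x y _ _ hx hy => rw [mul_add]; exact add_mem hx hy
  | smul k x _ hx => rw [mul_smul_comm]; exact Submodule.smul_mem _ k hx

theorem unitalGen_mem_monomialSpan (g : E.LeavittGen) :
    E.unitalGen K g ∈ E.monomialSpan K := by
  cases g with
  | vertex a =>
    rw [← unitalGen_vertex_mul_self]
    exact mul_mem_monomialSpan (.nil a) (.nil a)
  | edge e =>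
    rw [← unitalGen_edge_mul_tgt, ← unitalGen_vertex_mul_self, ← mul_assoc]
    exact mul_mem_monomialSpan (.cons e (.nil _)) (.nil _)
  | ghost e =>
    rw [← unitalGen_ghost_mul_src, ← unitalGen_tgt_mul_ghost, mul_assoc]
    exact mul_mem_monomialSpan (.nil _) (.cons e (.nil _))

theorem mem_monomialSpan {x : E.UnitalLeavitt K}
    (hx : x ∈ NonUnitalAlgebra.adjoin K (Set.range (E.unitalGen K))) :
    x ∈ E.monomialSpan K := by
  -- The second conjunct is what makes the induction pass through products.
  suffices x ∈ E.monomialSpan K ∧ ∀ y ∈ E.monomialSpan K, x * y ∈ E.monomialSpan K from this.1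
  induction hx using NonUnitalAlgebra.adjoin_induction with
  | mem x hx =>
    obtain ⟨g, rfl⟩ := hx
    exact ⟨unitalGen_mem_monomialSpan g, fun y hy => unitalGen_mul_mem_monomialSpan g hy⟩
  | zero => exact ⟨zero_mem _, fun y _ => by rw [zero_mul]; exact zero_mem _⟩
  | add x y _ _ hx hy =>
    exact ⟨add_mem hx.1 hy.1, fun z hz => by
      rw [add_mul]; exact add_mem (hx.2 z hz) (hy.2 z hz)⟩
  | mul x y _ _ hx hy =>
    exact ⟨hx.2 y hy.1, fun z hz => by rw [mul_assoc]; exact hx.2 _ (hy.2 z hz)⟩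
  | smul k x _ hx =>
    exact ⟨Submodule.smul_mem _ k hx.1, fun z hz => by
      rw [smul_mul_assoc]; exact Submodule.smul_mem _ k (hx.2 z hz)⟩

/-! ### Products of vertex ideals -/

theorem vertexElem_mul_self (a : E.Vertex) :
    E.vertexElem K a * E.vertexElem K a = E.vertexElem K a :=
  Subtype.ext (unitalGen_vertex_mul_self K E a)

theorem vertexElem_mem_vertexIdeal {X : Set E.Vertex} {a : E.Vertex} (ha : a ∈ X) :
    E.vertexElem K a ∈ E.vertexIdeal K X :=
  TwoSidedIdeal.subset_span ⟨a, ha, rfl⟩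

theorem vertexIdeal_mono {X Y : Set E.Vertex} (h : X ⊆ Y) :
    E.vertexIdeal K X ≤ E.vertexIdeal K Y :=
  TwoSidedIdeal.span_mono (Set.image_mono h)

variable {X Y : Set E.Vertex}

theorem vertexElem_mul_mul_vertexElem_mem (hX : E.IsHereditary X) (hY : E.IsHereditary Y)
    {a b : E.Vertex} (ha : a ∈ X) (hb : b ∈ Y) (r : E.LeavittPathAlgebra K) :
    E.vertexElem K a * r * E.vertexElem K b ∈ E.vertexIdeal K (X ∩ Y) := by
  suffices ∀ x ∈ E.monomialSpan K, ∃ d ∈ E.vertexIdeal K (X ∩ Y),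
      (d : E.UnitalLeavitt K) = E.unitalGen K (vertex a) * x * E.unitalGen K (vertex b) by
    obtain ⟨d, hd, hdr⟩ := this r (mem_monomialSpan r.2)
    rwa [← show d = E.vertexElem K a * r * E.vertexElem K b from Subtype.ext hdr]
  intro x hx
  induction hx using Submodule.span_induction with
  | mem x hx =>
    obtain ⟨a', b', c, p, q, hp, hq, rfl⟩ := hx
    by_cases haa : a = a'
    · by_cases hbb : b' = b
      · subst haa hbb
        have hc : c ∈ X ∩ Y := ⟨hX _ ha _ hp.reaches, hY _ hb _ hq.reaches⟩
        refine ⟨⟨p, hp.mem_adjoin⟩ * E.vertexElem K c * ⟨q, hq.mem_adjoin⟩,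
          TwoSidedIdeal.mul_mem_right _ _ _
            (TwoSidedIdeal.mul_mem_left _ _ _ (vertexElem_mem_vertexIdeal hc)), ?_⟩
        change p * E.unitalGen K (vertex c) * q = _
        rw [hp.mul_vertex, ← mul_assoc, hp.vertex_mul, mul_assoc, hq.mul_vertex]
      · refine ⟨0, zero_mem _, ?_⟩
        rw [mul_assoc, mul_assoc, hq.mul_vertex_of_ne hbb, mul_zero, mul_zero]
        rfl
    · refine ⟨0, zero_mem _, ?_⟩
      rw [← mul_assoc, hp.vertex_mul_of_ne haa, zero_mul, zero_mul]
      rfl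
  | zero => exact ⟨0, zero_mem _, by simp⟩
  | add x y _ _ hx hy =>
    obtain ⟨d, hd, hdx⟩ := hx
    obtain ⟨d', hd', hdy⟩ := hy
    exact ⟨d + d', add_mem hd hd', by rw [mul_add, add_mul, ← hdx, ← hdy]; rfl⟩
  | smul k x _ hx =>
    obtain ⟨d, hd, hdx⟩ := hx
    -- The ideal is only an ideal of the ring, so the scalar is moved onto the vertex `a`.
    refine ⟨(k • E.vertexElem K a) * d, TwoSidedIdeal.mul_mem_left _ _ _ hd, ?_⟩
    change (k • E.unitalGen K (vertex a)) * (d : E.UnitalLeavitt K) = _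
    rw [hdx, smul_mul_assoc, ← mul_assoc, ← mul_assoc, unitalGen_vertex_mul_self,
      mul_smul_comm, smul_mul_assoc]

/-- For hereditary `X` and `Y` one has `I(X) I(Y) ⊆ I(X ∩ Y)`. -/
theorem mul_mem_vertexIdeal_inter (hX : E.IsHereditary X) (hY : E.IsHereditary Y)
    {x y : E.LeavittPathAlgebra K} (hx : x ∈ E.vertexIdeal K X) (hy : y ∈ E.vertexIdeal K Y) :
    x * y ∈ E.vertexIdeal K (X ∩ Y) := by
  refine TwoSidedIdeal.mul_mem_of_mem_span (R := E.LeavittPathAlgebra K) ?_ ?_ hx hy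
  · rintro _ ⟨a, -, rfl⟩
    exact vertexElem_mul_self a
  · rintro _ ⟨a, ha, rfl⟩ r _ ⟨b, hb, rfl⟩
    exact vertexElem_mul_mul_vertexElem_mem hX hY ha hb r

end DirGraph

/-! ### Invariant point functors -/

namespace PointFunctor

open DirGraph

variable {K : Type w} [Field K] {E F : DirGraph.{u, v}}
  {f : E.LeavittPathAlgebra K ≃+* F.LeavittPathAlgebra K} {H H₁ H₂ : PointFunctor.{u, v}}

theorem isInvariant_iff : IsInvariant f H ↔
    (∀ a ∈ H.verts E, f (E.vertexElem K a) ∈ F.vertexIdeal K (H.verts F)) ∧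
      ∀ b ∈ H.verts F, f.symm (F.vertexElem K b) ∈ E.vertexIdeal K (H.verts E) := by
  refine (TwoSidedIdeal.image_span_eq_span_iff (R := E.LeavittPathAlgebra K)
    (R' := F.LeavittPathAlgebra K) f).trans ?_
  simp only [Set.forall_mem_image]
  rfl

theorem IsInvariant.sup (h₁ : IsInvariant f H₁) (h₂ : IsInvariant f H₂) :
    IsInvariant f (H₁ ⊔ H₂) := by
  rw [isInvariant_iff] at h₁ h₂ ⊢
  refine ⟨fun a ha => ?_, fun b hb => ?_⟩
  · rcases ha with ha | ha
    · exact vertexIdeal_mono Set.subset_union_left (h₁.1 a ha)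
    · exact vertexIdeal_mono Set.subset_union_right (h₂.1 a ha)
  · rcases hb with hb | hb
    · exact vertexIdeal_mono Set.subset_union_left (h₁.2 b hb)
    · exact vertexIdeal_mono Set.subset_union_right (h₂.2 b hb)

theorem IsInvariant.inf (hered₁ : H₁.IsHereditary) (hered₂ : H₂.IsHereditary)
    (h₁ : IsInvariant f H₁) (h₂ : IsInvariant f H₂) : IsInvariant f (H₁ ⊓ H₂) := by
  rw [isInvariant_iff] at h₁ h₂ ⊢
  refine ⟨fun a ha => ?_, fun b hb => ?_⟩
  · rw [← vertexElem_mul_self, map_mul]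
    exact mul_mem_vertexIdeal_inter (hered₁ F) (hered₂ F) (h₁.1 a ha.1) (h₂.1 a ha.2)
  · rw [← vertexElem_mul_self, map_mul]
    exact mul_mem_vertexIdeal_inter (hered₁ E) (hered₂ E) (h₁.2 b hb.1) (h₂.2 b hb.2)

end PointFunctor

theorem proposition2p9 {K : Type w} [Field K] {E F : DirGraph.{u, v}}
    (f : E.LeavittPathAlgebra K ≃+* F.LeavittPathAlgebra K)
    (H₁ H₂ : PointFunctor.{u, v})
    (hered₁ : PointFunctor.IsHereditary H₁) (sat₁ : PointFunctor.IsSaturated H₁)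
    (hered₂ : PointFunctor.IsHereditary H₂) (sat₂ : PointFunctor.IsSaturated H₂)
    (inv₁ : PointFunctor.IsInvariant f H₁) (inv₂ : PointFunctor.IsInvariant f H₂) :
    PointFunctor.IsInvariant f (H₁ ⊔ H₂) ∧ PointFunctor.IsInvariant f (H₁ ⊓ H₂) :=
  ⟨inv₁.sup inv₂, inv₁.inf hered₁ hered₂ inv₂⟩
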